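/- For $x\in(0,1]$ let $\zeta(s,x)$ be the Hurwitz zeta function, i.e. the meromorphic continuation in $s$ of $\sum_{n\ge 0}(n+x)^{-s}$, let $\zeta''(s,x)$ be its second derivative in $s$, and let the generalised Stieltjes constants $\gamma_n(x)$ be defined by the Laurent expansion at $s=1$ $$\zeta(s,x)=\frac1{s-1}+\sum_{n=0}^{\infty}\frac{(-1)^n}{n!}\,\gamma_n(x)\,(s-1)^n .$$ Write $\gamma_1=\gamma_1(1)$, let $\gamma$ be Euler's constant and $\psi=\Gamma'/\Gamma$ the digamma function. Then for all integers $1\le p<q$, $$\gamma_1\!\left(\frac pq\right)=\gamma_1+[\gamma+\log(2\pi q)]\left[\gamma+\psi\!\left(\frac pq\right)\right]+\sum_{r=1}^{q-1}\zeta''\!\left(0,\frac rq\right)\cos\frac{2\pi rp}{q}+\pi\sum_{r=1}^{q-1}\log\Gamma\!\left(\frac rq\right)\sin\frac{2\pi rp}{q}+\frac12\log^2 q+\log q\,\log(2\pi)$$ (Deninger's formula), and also $$\begin{aligned}\gamma_1\!\left(\frac pq\right)={}&\gamma_1-[\gamma+\log(2\pi)]\log(2\pi q)-\frac12\log^2 q+\sum_{r=1}^{q-1}\zeta''\!\left(0,\frac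 rq\right)\cos\frac{2\pi rp}{q}\\&-2[\gamma+\log(2\pi q)]\sum_{r=1}^{q-1}\log\Gamma\!\left(\frac rq\right)\cos\frac{2\pi rp}{q}+\pi\sum_{r=1}^{q-1}\log\Gamma\!\left(\frac rq\right)\sin\frac{2\pi rp}{q}-\frac{\pi}{2}[\gamma+\log(2\pi q)]\cot\frac{p\pi}{q}.\end{aligned}$$ -/

import Mathlib

open Filter Topology

namespace StieltjesRational

/-- The Hurwitz zeta function `ζ(s, x)` for real `0 < x ≤ 1`: the meromorphic continuation in `s` of
`∑ n ≥ 0, 1 / (n + x) ^ s`.  It is Mathlib's `HurwitzZeta.hurwitzZeta`, whose parameter lives on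
the circle `ℝ / ℤ` (so this is the usual function exactly on `0 < x ≤ 1`). -/
noncomputable def hurwitz (x : ℝ) (s : ℂ) : ℂ :=
  HurwitzZeta.hurwitzZeta (x : UnitAddCircle) s

/-- Sanity check: the Dirichlet series of `ζ(s, x)` for `0 < x ≤ 1`, `Re s > 1`. -/
theorem hasSum_hurwitz {x : ℝ} (hx : 0 < x) (hx1 : x ≤ 1) {s : ℂ} (hs : 1 < s.re) :
    HasSum (fun n : ℕ => 1 / ((n : ℂ) + (x : ℂ)) ^ s) (hurwitz x s) :=
  HurwitzZeta.hasSum_hurwitzZeta_of_one_lt_re ⟨hx.le, hx1⟩ hs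

/-- The regular part `ζ(s, x) - 1 / (s - 1)` at the pole `s = 1`, extended to `s = 1` by its
limit there. -/
noncomputable def regularPart (x : ℝ) : ℂ → ℂ :=
  Function.update (fun s : ℂ => hurwitz x s - 1 / (s - 1)) 1
    (limUnder (𝓝[≠] (1 : ℂ)) (fun s : ℂ => hurwitz x s - 1 / (s - 1)))

/-- The generalised Stieltjes constant `γ_n(x)`, `0 < x ≤ 1`: the numbers with
`ζ(s, x) = 1 / (s - 1) + ∑ n, (-1) ^ n / n! * γ_n(x) * (s - 1) ^ n`
(see `hasSum_laurent` below). -/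
noncomputable def stieltjes (n : ℕ) (x : ℝ) : ℂ :=
  (-1) ^ n * iteratedDeriv n (regularPart x) 1

/-- The `n`-th derivative `ζ^{(n)}(s, x)` of the Hurwitz zeta function in the variable `s`. -/
noncomputable def hurwitzDeriv (n : ℕ) (s : ℂ) (x : ℝ) : ℂ :=
  iteratedDeriv n (hurwitz x) s

theorem differentiable_regularPart (x : ℝ) : Differentiable ℂ (regularPart x) := by
  rw [← differentiableOn_univ]
  refine Complex.differentiableOn_update_limUnder_of_isLittleO univ_mem ?_ ?_
  · intro s hs
    have hs1 : s ≠ 1 := fun h => hs.2 h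
    refine DifferentiableAt.differentiableWithinAt ?_
    refine (HurwitzZeta.differentiableAt_hurwitzZeta _ hs1).sub ?_
    exact (differentiableAt_const _).div (differentiableAt_id.sub_const 1) (sub_ne_zero.mpr hs1)
  · rw [Asymptotics.isLittleO_iff_tendsto']
    · have h1 := HurwitzZeta.hurwitzZeta_residue_one (x : UnitAddCircle)
      have h2 : Tendsto (fun s : ℂ => s - 1) (𝓝[≠] 1) (𝓝 0) := by
        have : Tendsto (fun s : ℂ => s - 1) (𝓝 1) (𝓝 (1 - 1)) := tendsto_id.sub_const 1
        rw [sub_self] at this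
        exact this.mono_left nhdsWithin_le_nhds
      have h3 := (h1.sub_const 1).sub (h2.mul_const (hurwitz x 1 - 1 / ((1 : ℂ) - 1)))
      simp only [sub_self, zero_mul] at h3
      refine h3.congr' ?_
      filter_upwards [self_mem_nhdsWithin] with s hs
      have : s - 1 ≠ 0 := sub_ne_zero.mpr hs
      simp only [hurwitz]
      field_simp
      simp
    · filter_upwards [self_mem_nhdsWithin] with s hs h
      exact absurd (inv_eq_zero.mp h) (sub_ne_zero.mpr hs)

/-- Sanity check: the Laurent expansion that characterises the `γ_n(x)`. -/
theorem hasSum_laurent (x : ℝ) {s : ℂ} (hs : s ≠ 1) :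
    HasSum (fun n : ℕ => (-1 : ℂ) ^ n / (n.factorial : ℂ) * stieltjes n x * (s - 1) ^ n)
      (hurwitz x s - 1 / (s - 1)) := by
  have h := Complex.hasSum_taylorSeries_of_entire (differentiable_regularPart x) 1 s
  have hv : regularPart x s = hurwitz x s - 1 / (s - 1) := by
    simp [regularPart, Function.update_of_ne hs]
  rw [hv] at h
  refine Eq.mpr (congrArg (HasSum · _ _) (funext fun n => ?_)) h
  have hsq : (-1 : ℂ) ^ n * (-1) ^ n = 1 := by
    rw [← mul_pow]; simp
  simp only [stieltjes, div_eq_mul_inv, smul_eq_mul]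
  linear_combination ((n.factorial : ℂ)⁻¹ * iteratedDeriv n (regularPart x) 1
    * (s - 1) ^ n) * hsq

end StieltjesRational

/-!
Let `θ_r = 2π r p / q` and let `D(s) = ζ(1 - s, p / q) - ζ(1 - s, 1)`, an entire function. By
definition of the Stieltjes constants, `D(0) = γ₀(p / q) - γ₀(1)` and `D'(0) = γ₁(p / q) - γ₁(1)`.
Hurwitz's formula at the rational parameter `p / q` (`hurwitz_one_sub_rational`), combined with
Riemann's functional equation, reads `s D(s) = E(s) G(s)` with `E(s) = 2 Γ(s + 1) (2πq)⁻ˢ` and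
`G(s) = ∑_{1 ≤ r < q} ζ(s, r / q) cos (πs / 2 - θ_r) + ζ(s) (1 - q ^ s) cos (πs / 2)`.
Comparing Taylor coefficients at `s = 0` (`coefficients_of_functional_equation`) gives `G(0) = 0`,
`D(0) = 2 G'(0)` and `D'(0) = G''(0) - 2 (γ + log (2πq)) G'(0)`.

The derivatives of `G` at `0` (`hasTwoJet_dualSum`) follow from `ζ(0, x) = 1 / 2 - x`, from Lerch's
formula `ζ'(0, x) = log Γ(x) - log (2π) / 2`, and from the finite trigonometric sums
`∑ cos θ_r = -1`, `∑ sin θ_r = 0` and `∑ (1 / 2 - r / q) sin θ_r = cot (πp / q) / 2`. Inserting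
the explicit value of `G'(0)` gives the second formula; inserting instead
`2 G'(0) = D(0) = -(γ + ψ(p / q))` gives Deninger's formula.

The special values of `ζ(s, x)` at `s = 0` and `s = 1` all come from one identity
(`hurwitz_sub_hurwitz_one`): correcting the series for `ζ(s, x) - ζ(s, 1)` to first order in
`x - 1` makes it converge normally in a domain containing both points. The resulting series for
`log Γ` and `ψ` are evaluated with Euler's limit formula and with the convexity of `log Γ`.
-/

namespace StieltjesRational

/-! ### Continuation of the difference of two Hurwitz zeta functions -/

/-- Mean value inequality for complex powers of real numbers bounded below by `a > 0`. -/
lemma norm_ofReal_cpow_sub_le {a u v : ℝ} (ha : 0 < a) (hu : a ≤ u) (hv : a ≤ v) {w : ℂ}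
    (hw : w.re ≤ 1) :
    ‖(u : ℂ) ^ w - (v : ℂ) ^ w‖ ≤ ‖w‖ * a ^ (w.re - 1) * |u - v| := by
  rcases eq_or_ne w 0 with rfl | hw0
  · simp
  have hd : ∀ t ∈ Set.Ici a, HasDerivWithinAt (fun y : ℝ => (y : ℂ) ^ w)
      (w * (t : ℂ) ^ (w - 1)) (Set.Ici a) t := by
    intro t ht
    have ht0 : 0 < t := ha.trans_le ht
    have h := (hasDerivAt_ofReal_cpow_const' (r := w - 1) ht0.ne'
      (by intro h; apply hw0; linear_combination h)).const_mul w
    simp only [sub_add_cancel] at h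
    refine HasDerivAt.hasDerivWithinAt ?_
    convert! h using 2
    field_simp
  have hb : ∀ t ∈ Set.Ici a, ‖w * (t : ℂ) ^ (w - 1)‖ ≤ ‖w‖ * a ^ (w.re - 1) := by
    intro t ht
    rw [norm_mul, Complex.norm_cpow_eq_rpow_re_of_pos (ha.trans_le ht)]
    gcongr
    simpa using Real.rpow_le_rpow_of_nonpos ha ht (by linarith : w.re - 1 ≤ 0)
  simpa [Real.norm_eq_abs] using
    (convex_Ici a).norm_image_sub_le_of_norm_hasDerivWithin_le hd hb hv hu

/-- Second-order Taylor estimate for `u ↦ u ^ (-s)`. -/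
lemma norm_ofReal_cpow_taylor_le {a b : ℝ} (ha : 0 < a) (hab : a ≤ b) {s : ℂ}
    (hs : -2 ≤ s.re) :
    ‖(a : ℂ) ^ (-s) - (b : ℂ) ^ (-s) + s * (a - b) * (b : ℂ) ^ (-s - 1)‖
      ≤ ‖s‖ * (‖s + 1‖ * a ^ (-s.re - 2) * (b - a)) * (b - a) := by
  rcases eq_or_ne s 0 with rfl | hs0
  · simp
  have hd : ∀ t ∈ Set.Icc a b,
      HasDerivWithinAt (fun y : ℝ => (y : ℂ) ^ (-s) + s * y * (b : ℂ) ^ (-s - 1))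
      (-s * ((t : ℂ) ^ (-s - 1) - (b : ℂ) ^ (-s - 1))) (Set.Icc a b) t := by
    intro t ht
    have ht0 : 0 < t := ha.trans_le ht.1
    have h := (hasDerivAt_ofReal_cpow_const' (r := -s - 1) ht0.ne'
      (by intro h; apply hs0; linear_combination -h)).const_mul (-s)
    have h2 := ((Complex.ofRealCLM.hasDerivAt (x := t)).const_mul s).mul_const
      ((b : ℂ) ^ (-s - 1))
    simp only [sub_add_cancel, Complex.ofRealCLM_apply, Complex.ofReal_one, mul_one] at h h2
    refine HasDerivAt.hasDerivWithinAt ?_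
    convert! h.add h2 using 1
    · ext y
      simp only [Pi.add_apply]
      field_simp
    · ring
  have hb : ∀ t ∈ Set.Icc a b, ‖-s * ((t : ℂ) ^ (-s - 1) - (b : ℂ) ^ (-s - 1))‖
      ≤ ‖s‖ * (‖s + 1‖ * a ^ (-s.re - 2) * (b - a)) := by
    intro t ht
    rw [norm_mul, norm_neg]
    gcongr
    refine (norm_ofReal_cpow_sub_le ha ht.1 hab (w := -s - 1) ?_).trans ?_
    · simp; linarith
    · have e1 : ‖-s - 1‖ = ‖s + 1‖ := by rw [← norm_neg]; congr 1; ring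
      have e2 : (-s - 1).re - 1 = -s.re - 2 := by simp; ring
      have e3 : |t - b| ≤ b - a := by rw [abs_of_nonpos (by linarith [ht.2])]; linarith [ht.1]
      rw [e1, e2]
      gcongr
  have h := (convex_Icc a b).norm_image_sub_le_of_norm_hasDerivWithin_le hd hb
    (Set.right_mem_Icc.2 hab) (Set.left_mem_Icc.2 hab)
  rw [Real.norm_eq_abs, abs_of_nonpos (by linarith : a - b ≤ 0), neg_sub] at h
  refine le_of_eq_of_le ?_ h
  congr 1
  ring

/-- The `n`-th term of `ζ(s, x) - ζ(s, 1)`, corrected to first order in `x - 1`. -/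
noncomputable def correctedTerm (x : ℝ) (n : ℕ) (s : ℂ) : ℂ :=
  ((n + x : ℝ) : ℂ) ^ (-s) - ((n + 1 : ℝ) : ℂ) ^ (-s)
    + s * (x - 1) * ((n + 1 : ℝ) : ℂ) ^ (-s - 1)

/-- A convex open set containing `0`, `1` and points of real part greater than `1`, on which the
series of corrected terms converges normally. -/
def correctionDomain : Set ℂ := Metric.ball 0 3 ∩ {s | -1 / 2 < s.re}

lemma isOpen_correctionDomain : IsOpen correctionDomain :=
  Metric.isOpen_ball.inter (isOpen_lt continuous_const Complex.continuous_re)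

lemma isPreconnected_correctionDomain : IsPreconnected correctionDomain :=
  ((convex_ball 0 3).inter (convex_halfSpace_re_gt _)).isPreconnected

lemma norm_correctedTerm_le {x : ℝ} (hx : 0 < x) (hx1 : x ≤ 1) (n : ℕ) {s : ℂ}
    (hs : s ∈ correctionDomain) :
    ‖correctedTerm x n s‖ ≤ 12 * x ^ (-5 : ℝ) * ((n + 1 : ℕ) : ℝ) ^ (-(3 / 2) : ℝ) := by
  obtain ⟨hs1, hs2⟩ := hs
  rw [mem_ball_zero_iff] at hs1
  simp only [Set.mem_ofPred_eq] at hs2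
  have hre : s.re < 3 := (Complex.re_le_norm s).trans_lt hs1
  have hn : (0 : ℝ) ≤ n := n.cast_nonneg
  have h := norm_ofReal_cpow_taylor_le (a := n + x) (b := n + 1) (s := s) (by positivity)
    (by linarith) (by linarith)
  have e : ((n + x : ℝ) : ℂ) - ((n + 1 : ℝ) : ℂ) = x - 1 := by push_cast; ring
  rw [e] at h
  refine h.trans ?_
  have h4 : ‖s + 1‖ ≤ 4 := (norm_add_le _ _).trans (by simp; linarith)
  have hpow : (n + x) ^ (-s.re - 2) ≤ x ^ (-5 : ℝ) * ((n + 1 : ℕ) : ℝ) ^ (-(3 / 2) : ℝ) := by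
    push_cast
    -- `n + x ≥ (n + 1) x` because `x ≤ 1`
    calc (n + x) ^ (-s.re - 2) ≤ (x * (n + 1)) ^ (-s.re - 2) := by
          refine Real.rpow_le_rpow_of_nonpos (by positivity) ?_ (by linarith)
          nlinarith
      _ = x ^ (-s.re - 2) * ((n : ℝ) + 1) ^ (-s.re - 2) := Real.mul_rpow hx.le (by positivity)
      _ ≤ _ := by
          refine mul_le_mul (Real.rpow_le_rpow_of_exponent_ge hx hx1 (by linarith))
            (Real.rpow_le_rpow_of_exponent_le (by linarith) (by linarith))
            (by positivity) (by positivity)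
  have hp : 0 ≤ (n + x) ^ (-s.re - 2) := by positivity
  have h0 : 0 ≤ (n + 1 : ℝ) - (n + x) := by linarith
  have h1 : (n + 1 : ℝ) - (n + x) ≤ 1 := by linarith
  calc ‖s‖ * (‖s + 1‖ * (n + x) ^ (-s.re - 2) * (n + 1 - (n + x))) * (n + 1 - (n + x))
      ≤ 3 * (4 * (x ^ (-5 : ℝ) * ((n + 1 : ℕ) : ℝ) ^ (-(3 / 2) : ℝ)) * 1) * 1 := by
        gcongr
    _ = _ := by ring

lemma summable_correctedTerm_bound (x : ℝ) :
    Summable fun n : ℕ => 12 * x ^ (-5 : ℝ) * ((n + 1 : ℕ) : ℝ) ^ (-(3 / 2) : ℝ) := by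
  refine Summable.mul_left _ ?_
  exact (summable_nat_add_iff 1 (f := fun n : ℕ => (n : ℝ) ^ (-(3 / 2) : ℝ))).2
    (Real.summable_nat_rpow.2 (by norm_num))

lemma differentiable_correctedTerm {x : ℝ} (hx : 0 < x) (n : ℕ) :
    Differentiable ℂ (correctedTerm x n) := by
  have h1 : ((n + x : ℝ) : ℂ) ≠ 0 := by exact_mod_cast (by positivity : (n + x : ℝ) ≠ 0)
  have h2 : ((n + 1 : ℝ) : ℂ) ≠ 0 := by exact_mod_cast (by positivity : (n + 1 : ℝ) ≠ 0)
  unfold correctedTerm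
  intro s
  refine DifferentiableAt.add (DifferentiableAt.sub ?_ ?_) (DifferentiableAt.mul (by fun_prop) ?_)
  · exact DifferentiableAt.const_cpow (by fun_prop) (Or.inl h1)
  · exact DifferentiableAt.const_cpow (by fun_prop) (Or.inl h2)
  · exact DifferentiableAt.const_cpow (by fun_prop) (Or.inl h2)

lemma differentiableOn_tsum_correctedTerm {x : ℝ} (hx : 0 < x) (hx1 : x ≤ 1) :
    DifferentiableOn ℂ (fun s => ∑' n, correctedTerm x n s) correctionDomain :=
  Complex.differentiableOn_tsum_of_summable_norm (summable_correctedTerm_bound x)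
    (fun n => (differentiable_correctedTerm hx n).differentiableOn) isOpen_correctionDomain
    fun n _ hs => norm_correctedTerm_le hx hx1 n hs

lemma hurwitz_one (s : ℂ) : hurwitz 1 s = riemannZeta s := by
  simp only [hurwitz, AddCircle.coe_period]
  rw [HurwitzZeta.hurwitzZeta_zero]

/-- On a domain reaching to the left of `Re s = 0`, the difference `ζ(s, x) - ζ(s, 1)` is the sum
of the corrected terms plus the correction, which is an entire function because the pole of
`ζ(s + 1)` at `s = 0` is cancelled by the factor `s`. -/
lemma hurwitz_sub_hurwitz_one {x : ℝ} (hx : 0 < x) (hx1 : x ≤ 1) {s : ℂ}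
    (hs : s ∈ correctionDomain) :
    hurwitz x s - hurwitz 1 s = ∑' n, correctedTerm x n s + (1 - x) * riemannZeta₁ (s + 1) := by
  have hf : AnalyticOnNhd ℂ (fun s => hurwitz x s - hurwitz 1 s) correctionDomain :=
    (HurwitzZeta.differentiable_hurwitzZeta_sub_hurwitzZeta _ _).differentiableOn.analyticOnNhd
      isOpen_correctionDomain
  have hg : AnalyticOnNhd ℂ
      (fun s => ∑' n, correctedTerm x n s + (1 - x) * riemannZeta₁ (s + 1)) correctionDomain := by
    refine DifferentiableOn.analyticOnNhd ?_ isOpen_correctionDomain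
    refine (differentiableOn_tsum_correctedTerm hx hx1).add ?_
    exact Differentiable.differentiableOn (by fun_prop)
  refine hf.eqOn_of_preconnected_of_eventuallyEq hg isPreconnected_correctionDomain
    (z₀ := 2) ⟨by simp; norm_num, by simp; norm_num⟩ ?_ hs
  filter_upwards [(isOpen_lt continuous_const Complex.continuous_re).mem_nhds
    (show (1 : ℝ) < (2 : ℂ).re by simp)] with s hs
  have hs : 1 < s.re := hs
  have hs0 : s ≠ 0 := by rintro rfl; simp at hs; linarith
  have h1 := hasSum_hurwitz hx hx1 hs
  have h2 := hasSum_hurwitz one_pos le_rfl hs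
  have h3 := (hasSum_hurwitz one_pos le_rfl (s := s + 1) (by simp; linarith)).mul_left
    (s * (x - 1))
  have hz : hurwitz 1 (s + 1) = s⁻¹ * riemannZeta₁ (s + 1) := by
    rw [hurwitz_one, riemannZeta_eq_inv_sub_mul (by simpa using hs0)]
    simp
  have h := ((h1.sub h2).add h3).tsum_eq
  have e : ∑' n, correctedTerm x n s
      = hurwitz x s - hurwitz 1 s + s * (x - 1) * hurwitz 1 (s + 1) := by
    rw [← h]
    congr 1
    ext n
    rw [correctedTerm, show -s - 1 = -(s + 1) by ring, Complex.cpow_neg, Complex.cpow_neg,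
      Complex.cpow_neg]
    simp
  rw [e, hz]
  field_simp
  ring

/-! ### The value at the origin -/

lemma zero_mem_correctionDomain : (0 : ℂ) ∈ correctionDomain := by
  constructor <;> norm_num

lemma one_mem_correctionDomain : (1 : ℂ) ∈ correctionDomain := by
  constructor <;> norm_num

lemma hurwitz_zero {x : ℝ} (hx : 0 < x) (hx1 : x ≤ 1) : hurwitz x 0 = 1 / 2 - x := by
  have h := hurwitz_sub_hurwitz_one hx hx1 zero_mem_correctionDomain
  have h0 : ∀ n, correctedTerm x n 0 = 0 := fun n => by simp [correctedTerm]
  simp only [h0, tsum_zero, zero_add, riemannZeta₁_one, hurwitz_one, riemannZeta_zero] at h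
  linear_combination h

/-! ### Lerch's formula -/

lemma tendsto_log_natCast_add_sub_log (x : ℝ) :
    Tendsto (fun n : ℕ => Real.log (n + x) - Real.log n) atTop (𝓝 0) :=
  (Real.tendsto_log_comp_add_sub_log x).comp tendsto_natCast_atTop_atTop

lemma sum_range_inv_eq_harmonic (N : ℕ) :
    ∑ n ∈ Finset.range N, 1 / ((n : ℝ) + 1) = (harmonic N : ℝ) := by
  simp [harmonic]

/-- The logarithm of the Weierstrass product for `Γ`, obtained from Euler's limit formula. -/
lemma tendsto_sum_log_sub_log {x : ℝ} (hx : 0 < x) :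
    Tendsto (fun N : ℕ => ∑ n ∈ Finset.range N,
      (-Real.log (n + x) + Real.log (n + 1) + (x - 1) / (n + 1))) atTop
      (𝓝 (Real.log (Real.Gamma x) + (x - 1) * Real.eulerMascheroniConstant)) := by
  have h := ((Real.BohrMollerup.tendsto_log_gamma hx).add
    (Real.tendsto_harmonic_sub_log.const_mul (x - 1))).add (tendsto_log_natCast_add_sub_log x)
  rw [add_zero] at h
  refine h.congr fun N => ?_
  have h1 : ∑ n ∈ Finset.range N, Real.log ((n : ℝ) + 1) = Real.log (N.factorial : ℝ) := by
    induction N with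
    | zero => simp
    | succ N ih =>
      rw [Finset.sum_range_succ, ih, Nat.factorial_succ]
      push_cast
      rw [Real.log_mul (by positivity) (by positivity)]
      ring
  have h2 : ∑ n ∈ Finset.range N, (x - 1) / ((n : ℝ) + 1) = (x - 1) * harmonic N := by
    rw [← sum_range_inv_eq_harmonic, Finset.mul_sum]
    simp [div_eq_mul_inv]
  rw [Finset.sum_add_distrib, Finset.sum_add_distrib, h1, h2, Finset.sum_neg_distrib,
    Real.BohrMollerup.logGammaSeq, Finset.sum_range_succ]
  simp only [add_comm x]
  ring

lemma deriv_correctedTerm_zero {x : ℝ} (hx : 0 < x) (n : ℕ) :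
    deriv (correctedTerm x n) 0
      = ((-Real.log (n + x) + Real.log (n + 1) + (x - 1) / (n + 1) : ℝ) : ℂ) := by
  have h1 : ((n + x : ℝ) : ℂ) ≠ 0 := by exact_mod_cast (by positivity : (n + x : ℝ) ≠ 0)
  have h2 : ((n + 1 : ℝ) : ℂ) ≠ 0 := by exact_mod_cast (by positivity : (n + 1 : ℝ) ≠ 0)
  have e1 := (hasDerivAt_neg (0 : ℂ)).const_cpow (c := ((n + x : ℝ) : ℂ)) (Or.inl h1)
  have e2 := (hasDerivAt_neg (0 : ℂ)).const_cpow (c := ((n + 1 : ℝ) : ℂ)) (Or.inl h2)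
  have e3 := ((hasDerivAt_neg (0 : ℂ)).sub_const 1).const_cpow (c := ((n + 1 : ℝ) : ℂ))
    (Or.inl h2)
  have e4 := (((hasDerivAt_id (0 : ℂ)).mul_const ((x : ℂ) - 1)).mul e3)
  have h := ((e1.sub e2).add e4).deriv
  refine Eq.trans ?_ (h.trans ?_)
  · rfl
  · simp only [id, neg_zero, Complex.cpow_zero, zero_sub, Complex.cpow_neg_one]
    push_cast
    rw [Complex.ofReal_log (by positivity), Complex.ofReal_log (by positivity)]
    push_cast
    field_simp
    ring

/-- **Lerch's formula**: `ζ'(0, x) = log Γ(x) - log (2π) / 2`. -/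
lemma deriv_hurwitz_zero {x : ℝ} (hx : 0 < x) (hx1 : x ≤ 1) :
    deriv (hurwitz x) 0
      = ((Real.log (Real.Gamma x) - Real.log (2 * Real.pi) / 2 : ℝ) : ℂ) := by
  have hsum := Complex.hasSum_deriv_of_summable_norm (summable_correctedTerm_bound x)
    (fun n => (differentiable_correctedTerm hx n).differentiableOn) isOpen_correctionDomain
    (fun n _ hs => norm_correctedTerm_le hx hx1 n hs) zero_mem_correctionDomain
  simp only [deriv_correctedTerm_zero hx] at hsum
  have hT := tendsto_nhds_unique hsum.tendsto_sum_nat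
    ((Complex.continuous_ofReal.tendsto _).comp (tendsto_sum_log_sub_log hx) |>.congr
      fun N => by simp only [Function.comp_apply, Complex.ofReal_sum])
  have hTd : DifferentiableAt ℂ (fun s => ∑' n, correctedTerm x n s) 0 :=
    (differentiableOn_tsum_correctedTerm hx hx1).differentiableAt
      (isOpen_correctionDomain.mem_nhds zero_mem_correctionDomain)
  have hz : HasDerivAt (fun s => riemannZeta₁ (s + 1)) (Real.eulerMascheroniConstant : ℂ) 0 := by
    have h : HasDerivAt riemannZeta₁ (Real.eulerMascheroniConstant : ℂ) (0 + 1) := by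
      rw [zero_add, ← deriv_riemannZeta₁_one]
      exact (differentiable_riemannZeta₁ 1).hasDerivAt
    exact h.comp_add_const 0 1
  have hone : HasDerivAt (hurwitz 1) (-Complex.log (2 * Real.pi) / 2) 0 := by
    rw [show hurwitz 1 = riemannZeta from funext hurwitz_one, ← deriv_riemannZeta_zero]
    exact (differentiableAt_riemannZeta (by norm_num)).hasDerivAt
  have hx' := (hTd.hasDerivAt.add (hz.const_mul (1 - (x : ℂ)))).add hone
  have heq : hurwitz x =ᶠ[𝓝 0]
      ((fun s => ∑' n, correctedTerm x n s) + fun s => (1 - (x : ℂ)) * riemannZeta₁ (s + 1))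
        + hurwitz 1 := by
    filter_upwards [isOpen_correctionDomain.mem_nhds zero_mem_correctionDomain] with s hs
    simp only [Pi.add_apply]
    rw [← hurwitz_sub_hurwitz_one hx hx1 hs]
    ring
  rw [(hx'.congr_of_eventuallyEq heq).deriv, hT]
  push_cast
  rw [Complex.ofReal_log (x := 2 * Real.pi) (by positivity)]
  push_cast
  ring

/-! ### The digamma function as a constant term -/

/-- The limit formula for the digamma function. Convexity of `log Γ` bounds
`(log Γ)'(x + n)` between `log (x + n - 1)` and `log (x + n)`. -/
lemma tendsto_log_sub_sum_inv {x : ℝ} (hx : 0 < x) :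
    Tendsto (fun N : ℕ => Real.log N - ∑ n ∈ Finset.range N, 1 / ((n : ℝ) + x)) atTop
      (𝓝 (deriv (Real.log ∘ Real.Gamma) x)) := by
  set f := Real.log ∘ Real.Gamma with hf
  have hc : ConvexOn ℝ (Set.Ioi 0) f := Real.convexOn_log_Gamma
  have h_rec (y : ℝ) (hy : 0 < y) : f (y + 1) = f y + Real.log y := by
    simp only [f, Function.comp_apply, Real.Gamma_add_one hy.ne',
      Real.log_mul hy.ne' (Real.Gamma_pos_of_pos hy).ne', add_comm]
  have hder {y : ℝ} (hy : 0 < y) : DifferentiableAt ℝ f y := by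
    refine ((Real.differentiableAt_Gamma fun m => ?_).log (Real.Gamma_pos_of_pos hy).ne')
    exact ne_of_gt (by linarith [m.cast_nonneg (α := ℝ)])
  have hder_rec (y : ℝ) (hy : 0 < y) : deriv f (y + 1) = deriv f y + 1 / y := by
    rw [← deriv_comp_add_const, one_div, ← Real.deriv_log,
      ← deriv_add (hder hy) (Real.differentiableAt_log hy.ne')]
    apply EventuallyEq.deriv_eq
    filter_upwards [eventually_gt_nhds hy] using h_rec
  have hder_nat (n : ℕ) :
      deriv f (n + x) = deriv f x + ∑ k ∈ Finset.range n, 1 / ((k : ℝ) + x) := by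
    induction n with
    | zero => simp
    | succ n ih =>
      rw [Finset.sum_range_succ, Nat.cast_succ, add_right_comm,
        hder_rec (n + x) (by positivity), ih]
      ring
  have hlb (y : ℝ) (hy : 0 < y) : Real.log y ≤ deriv f (y + 1) := by
    refine (le_of_eq ?_).trans <| hc.slope_le_deriv (Set.mem_Ioi.mpr hy)
      (by positivity : _ < (_ : ℝ)) (by linarith) (hder <| by positivity)
    rw [slope_def_field, add_sub_cancel_left, div_one, h_rec y hy, add_sub_cancel_left]
  have hub (y : ℝ) (hy : 0 < y) : deriv f y ≤ Real.log y := by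
    refine (hc.deriv_le_slope (Set.mem_Ioi.mpr hy) (by positivity : (0 : ℝ) < y + 1)
      (by linarith) (hder hy)).trans (le_of_eq ?_)
    rw [slope_def_field, add_sub_cancel_left, div_one, h_rec y hy, add_sub_cancel_left]
  have hlim : Tendsto (fun n : ℕ => deriv f (n + x) - Real.log n) atTop (𝓝 0) := by
    refine tendsto_of_tendsto_of_tendsto_of_le_of_le'
      (tendsto_log_natCast_add_sub_log (x - 1)) (tendsto_log_natCast_add_sub_log x) ?_ ?_
    · filter_upwards [eventually_ge_atTop 1] with n hn
      have hn' : (1 : ℝ) ≤ n := by exact_mod_cast hn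
      have := hlb (n + (x - 1)) (by linarith)
      rw [show (n : ℝ) + (x - 1) + 1 = n + x by ring] at this
      linarith
    · filter_upwards with n
      linarith [hub (n + x) (by positivity)]
  have h := hlim.const_sub (deriv f x)
  rw [sub_zero] at h
  refine h.congr fun n => ?_
  rw [hder_nat]
  ring

lemma digamma_ofReal {x : ℝ} (hx : 0 < x) :
    Complex.digamma x = ((deriv (Real.log ∘ Real.Gamma) x : ℝ) : ℂ) := by
  have hm : ∀ m : ℕ, x ≠ -m := fun m => ne_of_gt (by linarith [m.cast_nonneg (α := ℝ)])
  have hR := Real.differentiableAt_Gamma hm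
  have hC : DifferentiableAt ℂ Complex.Gamma x :=
    Complex.differentiableAt_Gamma _ fun m h => hm m (by exact_mod_cast h)
  have h1 : HasDerivAt (fun y : ℝ => Complex.Gamma y) (deriv Complex.Gamma x) x :=
    hC.hasDerivAt.comp_ofReal
  have h2 : HasDerivAt (fun y : ℝ => Complex.Gamma y) ((deriv Real.Gamma x : ℝ) : ℂ) x := by
    simp only [Complex.Gamma_ofReal]
    exact hR.hasDerivAt.ofReal_comp
  rw [Complex.digamma_def, logDeriv_apply, h1.unique h2, Complex.Gamma_ofReal,
    Function.comp_def, deriv.log hR (Real.Gamma_pos_of_pos hx).ne']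
  push_cast
  rfl

/-- The constant terms at the pole satisfy `γ₀(x) - γ₀(1) = -(γ + ψ(x))`. Although `ζ(s, x)`
takes a junk value at `s = 1` separately, the difference `ζ(s, x) - ζ(s, 1)` is entire with its
correct value there. -/
lemma hurwitz_sub_hurwitz_one_at_one {x : ℝ} (hx : 0 < x) (hx1 : x ≤ 1) :
    hurwitz x 1 - hurwitz 1 1
      = -((Real.eulerMascheroniConstant : ℂ) + Complex.digamma x) := by
  have hs : Summable fun n => correctedTerm x n 1 :=
    Summable.of_norm_bounded (summable_correctedTerm_bound x)
      fun n => norm_correctedTerm_le hx hx1 n one_mem_correctionDomain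
  have hz : HasSum (fun n : ℕ => 1 / ((n : ℂ) + ((1 : ℝ) : ℂ)) ^ (2 : ℂ)) (riemannZeta₁ (1 + 1)) := by
    have h := hasSum_hurwitz one_pos le_rfl (s := 2) (by simp)
    rw [hurwitz_one, riemannZeta_eq_inv_sub_mul (by norm_num)] at h
    rw [show (1 : ℂ) + 1 = 2 by norm_num]
    convert h using 1
    norm_num
  have h := hs.hasSum.add (hz.mul_left (1 - (x : ℂ)))
  rw [← hurwitz_sub_hurwitz_one hx hx1 one_mem_correctionDomain] at h
  have hlim := (tendsto_log_sub_sum_inv hx).neg.sub Real.tendsto_harmonic_sub_log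
  rw [digamma_ofReal hx, ← Complex.ofReal_add, ← Complex.ofReal_neg]
  refine tendsto_nhds_unique h.tendsto_sum_nat ?_
  rw [show -(Real.eulerMascheroniConstant + deriv (Real.log ∘ Real.Gamma) x)
    = -deriv (Real.log ∘ Real.Gamma) x - Real.eulerMascheroniConstant by ring]
  refine ((Complex.continuous_ofReal.tendsto _).comp hlim).congr fun N => ?_
  have e : ∀ n : ℕ, correctedTerm x n 1
      + (1 - (x : ℂ)) * (1 / ((n : ℂ) + ((1 : ℝ) : ℂ)) ^ (2 : ℂ))
      = ((1 / ((n : ℝ) + x) - 1 / ((n : ℝ) + 1) : ℝ) : ℂ) := by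
    intro n
    have h2 : ((n + 1 : ℝ) : ℂ) ≠ 0 := by exact_mod_cast (by positivity : (n + 1 : ℝ) ≠ 0)
    rw [correctedTerm, show (-1 - 1 : ℂ) = -(2 : ℕ) by norm_num,
      show (2 : ℂ) = ((2 : ℕ) : ℂ) by norm_num, Complex.cpow_neg, Complex.cpow_neg,
      Complex.cpow_neg, Complex.cpow_natCast, Complex.cpow_natCast, Complex.cpow_one,
      Complex.cpow_one]
    push_cast
    ring
  simp only [e, ← Complex.ofReal_sum, Function.comp_apply, Finset.sum_sub_distrib,
    sum_range_inv_eq_harmonic]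
  congr 1
  ring

/-! ### Hurwitz's formula at rational parameters -/

/-- The angle `2π r p / q`. -/
noncomputable def angle (p q r : ℕ) : ℝ := 2 * Real.pi * (r : ℝ) * (p : ℝ) / (q : ℝ)

/-- The cosine transform `∑ ζ(s, r / q) cos (2π r p / q)` over `1 ≤ r < q`. -/
noncomputable def cosTransform (p q : ℕ) (s : ℂ) : ℂ :=
  ∑ r ∈ Finset.Ico 1 q, hurwitz ((r : ℝ) / q) s * ((Real.cos (angle p q r) : ℝ) : ℂ)

/-- The sine transform `∑ ζ(s, r / q) sin (2π r p / q)` over `1 ≤ r < q`. -/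
noncomputable def sinTransform (p q : ℕ) (s : ℂ) : ℂ :=
  ∑ r ∈ Finset.Ico 1 q, hurwitz ((r : ℝ) / q) s * ((Real.sin (angle p q r) : ℝ) : ℂ)

lemma sum_zmod_eq_sum_range {q : ℕ} [NeZero q] (f : ZMod q → ℂ) :
    ∑ k, f k = ∑ r ∈ Finset.range q, f (r : ZMod q) := by
  refine Finset.sum_bij' (fun k _ => k.val) (fun r _ => (r : ZMod q)) ?_ ?_ ?_ ?_ ?_
  · intro k _; simpa using ZMod.val_lt k
  · simp
  · simp
  · intro r hr; exact ZMod.val_cast_of_lt (by simpa using hr)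
  · simp

lemma sum_range_eq_add_sum_Ico_one {q : ℕ} (hq : 0 < q) (f : ℕ → ℂ) :
    ∑ r ∈ Finset.range q, f r = f 0 + ∑ r ∈ Finset.Ico 1 q, f r := by
  rw [Finset.range_eq_Ico, Finset.sum_eq_sum_Ico_succ_bot hq]

/-- The exponential zeta function at a rational parameter in terms of Hurwitz zeta functions. -/
lemma expZeta_rational {p q : ℕ} (hp : 1 ≤ p) (hpq : p < q) (s : ℂ) :
    HurwitzZeta.expZeta (((p : ℝ) / q : ℝ) : UnitAddCircle) s
        = (q : ℂ) ^ (-s) *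
          (riemannZeta s + cosTransform p q s + Complex.I * sinTransform p q s) ∧
      HurwitzZeta.expZeta (-(((p : ℝ) / q : ℝ) : UnitAddCircle)) s
        = (q : ℂ) ^ (-s) *
          (riemannZeta s + cosTransform p q s - Complex.I * sinTransform p q s) := by
  have hq : 0 < q := by omega
  have : NeZero q := ⟨hq.ne'⟩
  have hne : (p : ZMod q) ≠ 0 := by
    rw [Ne, ZMod.natCast_eq_zero_iff]
    exact Nat.not_dvd_of_pos_of_lt hp hpq
  have hcirc : ∀ r : ℕ, r < q →
      ZMod.toAddCircle (r : ZMod q) = (((r : ℝ) / q : ℝ) : UnitAddCircle) := by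
    intro r hr
    rw [ZMod.toAddCircle_apply, ZMod.val_cast_of_lt hr]
  -- both signs of the parameter are treated at once, as `σ = ±1`
  have key : ∀ (σ : ℤ), (σ * p : ZMod q) ≠ 0 →
      HurwitzZeta.expZeta (ZMod.toAddCircle (σ * p : ZMod q)) s = (q : ℂ) ^ (-s) *
        (riemannZeta s + ∑ r ∈ Finset.Ico 1 q,
          Complex.exp (σ * (angle p q r) * Complex.I) * hurwitz ((r : ℝ) / q) s) := by
    intro σ hσ
    rw [← ZMod.LFunction_stdAddChar_eq_expZeta _ _ (Or.inl hσ), ZMod.LFunction,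
      sum_zmod_eq_sum_range, sum_range_eq_add_sum_Ico_one hq]
    congr 2
    · simp [HurwitzZeta.hurwitzZeta_zero]
    · refine Finset.sum_congr rfl fun r hr => ?_
      rw [hcirc r (Finset.mem_Ico.1 hr).2]
      have e : (σ * p * (r : ℕ) : ZMod q) = ((σ * p * r : ℤ) : ZMod q) := by push_cast; rfl
      rw [e, ZMod.stdAddChar_coe, hurwitz]
      congr 2
      simp only [angle]
      push_cast
      ring
  have h1 := key 1 (by simpa using hne)
  have h2 := key (-1) (by simpa using hne)
  simp only [Int.cast_one, one_mul, Int.cast_neg, neg_mul, map_neg, hcirc p hpq] at h1 h2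
  rw [h1, h2, cosTransform, sinTransform]
  simp only [Finset.mul_sum, add_assoc, add_sub_assoc, ← Finset.sum_add_distrib,
    ← Finset.sum_sub_distrib]
  constructor
  · congr 2
    refine Finset.sum_congr rfl fun r _ => ?_
    rw [Complex.exp_mul_I, ← Complex.ofReal_cos, ← Complex.ofReal_sin]
    ring
  · congr 2
    refine Finset.sum_congr rfl fun r _ => ?_
    rw [← neg_mul, Complex.exp_mul_I, Complex.cos_neg, Complex.sin_neg, ← Complex.ofReal_cos,
      ← Complex.ofReal_sin]
    ring

/-- **Hurwitz's formula** at a rational parameter, as a relation between Hurwitz zeta functions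
with parameters of denominator `q`. -/
lemma hurwitz_one_sub_rational {p q : ℕ} (hp : 1 ≤ p) (hpq : p < q) {s : ℂ}
    (hs : ∀ n : ℕ, s ≠ -n) (hs1 : s ≠ 1) :
    hurwitz ((p : ℝ) / q) (1 - s) = 2 * (2 * Real.pi) ^ (-s) * Complex.Gamma s * (q : ℂ) ^ (-s) *
      (Complex.cos (Real.pi * s / 2) * (riemannZeta s + cosTransform p q s)
        + Complex.sin (Real.pi * s / 2) * sinTransform p q s) := by
  obtain ⟨h1, h2⟩ := expZeta_rational hp hpq s
  rw [hurwitz, HurwitzZeta.hurwitzZeta_one_sub _ hs (Or.inr hs1), h1, h2,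
    show -↑Real.pi * Complex.I * s / 2 = -(Real.pi * s / 2) * Complex.I by ring,
    show ↑Real.pi * Complex.I * s / 2 = (Real.pi * s / 2) * Complex.I by ring,
    Complex.exp_mul_I, Complex.exp_mul_I, Complex.cos_neg, Complex.sin_neg]
  linear_combination (-2 * (2 * Real.pi : ℂ) ^ (-s) * Complex.Gamma s * (q : ℂ) ^ (-s)
    * Complex.sin (Real.pi * s / 2) * sinTransform p q s) * Complex.I_sq

/-! ### Taylor expansion to second order at the origin -/

lemma hasDerivAt_cos_mul (k s : ℂ) :
    HasDerivAt (fun s => Complex.cos (k * s)) (-Complex.sin (k * s) * k) s := by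
  simpa using ((hasDerivAt_id s).const_mul k).ccos

lemma hasDerivAt_sin_mul (k s : ℂ) :
    HasDerivAt (fun s => Complex.sin (k * s)) (Complex.cos (k * s) * k) s := by
  simpa using ((hasDerivAt_id s).const_mul k).csin

/-- `f` is analytic at `0`, with value `a`, first derivative `b` and second derivative `c` there. -/
structure HasTwoJet (f : ℂ → ℂ) (a b c : ℂ) : Prop where
  analyticAt : AnalyticAt ℂ f 0
  value : f 0 = a
  deriv_one : deriv f 0 = b
  deriv_two : iteratedDeriv 2 f 0 = c

namespace HasTwoJet

variable {f g : ℂ → ℂ} {a b c a' b' c' : ℂ}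

lemma add (hf : HasTwoJet f a b c) (hg : HasTwoJet g a' b' c') :
    HasTwoJet (fun s => f s + g s) (a + a') (b + b') (c + c') where
  analyticAt := hf.analyticAt.fun_add hg.analyticAt
  value := by rw [hf.value, hg.value]
  deriv_one := by
    rw [deriv_fun_add hf.analyticAt.differentiableAt hg.analyticAt.differentiableAt,
      hf.deriv_one, hg.deriv_one]
  deriv_two := by
    rw [iteratedDeriv_fun_add hf.analyticAt.contDiffAt hg.analyticAt.contDiffAt, hf.deriv_two,
      hg.deriv_two]

lemma mul (hf : HasTwoJet f a b c) (hg : HasTwoJet g a' b' c') :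
    HasTwoJet (fun s => f s * g s) (a * a') (b * a' + a * b')
      (c * a' + 2 * (b * b') + a * c') where
  analyticAt := hf.analyticAt.fun_mul hg.analyticAt
  value := by rw [hf.value, hg.value]
  deriv_one := by
    rw [deriv_fun_mul hf.analyticAt.differentiableAt hg.analyticAt.differentiableAt,
      hf.deriv_one, hg.deriv_one, hf.value, hg.value]
  deriv_two := by
    rw [iteratedDeriv_fun_mul hf.analyticAt.contDiffAt hg.analyticAt.contDiffAt]
    simp only [Finset.sum_range_succ, Finset.sum_range_zero, iteratedDeriv_zero,
      iteratedDeriv_one, Nat.sub_zero, Nat.sub_self, Nat.reduceSub, hf.value, hg.value,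
      hf.deriv_one, hg.deriv_one, hf.deriv_two, hg.deriv_two]
    norm_num
    ring

lemma sum {ι : Type*} (t : Finset ι) {F : ι → ℂ → ℂ} {a b c : ι → ℂ}
    (h : ∀ i ∈ t, HasTwoJet (F i) (a i) (b i) (c i)) :
    HasTwoJet (fun s => ∑ i ∈ t, F i s) (∑ i ∈ t, a i) (∑ i ∈ t, b i) (∑ i ∈ t, c i) where
  analyticAt := Finset.analyticAt_fun_sum t fun i hi => (h i hi).analyticAt
  value := Finset.sum_congr rfl fun i hi => (h i hi).value
  deriv_one := by
    rw [deriv_fun_sum fun i hi => (h i hi).analyticAt.differentiableAt]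
    exact Finset.sum_congr rfl fun i hi => (h i hi).deriv_one
  deriv_two := by
    rw [iteratedDeriv_fun_sum fun i hi => (h i hi).analyticAt.contDiffAt]
    exact Finset.sum_congr rfl fun i hi => (h i hi).deriv_two

lemma of_hasDerivAt {f' : ℂ → ℂ} (ha : f 0 = a) (h : ∀ s, HasDerivAt f (f' s) s) (hb : f' 0 = b)
    (hc : HasDerivAt f' c 0) : HasTwoJet f a b c where
  analyticAt := Differentiable.analyticAt (fun s => (h s).differentiableAt) 0
  value := ha
  deriv_one := by rw [(h 0).deriv, hb]
  deriv_two := by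
    rw [iteratedDeriv_succ, iteratedDeriv_one, funext fun s => (h s).deriv, hc.deriv]

lemma const (a : ℂ) : HasTwoJet (fun _ => a) a 0 0 :=
  of_hasDerivAt rfl (fun s => hasDerivAt_const s a) rfl (hasDerivAt_const 0 0)

lemma id : HasTwoJet (fun s => s) 0 1 0 :=
  of_hasDerivAt rfl (fun s => hasDerivAt_id s) rfl (hasDerivAt_const 0 1)

lemma exp_mul (k : ℂ) : HasTwoJet (fun s => Complex.exp (k * s)) 1 k (k ^ 2) := by
  have h : ∀ s : ℂ, HasDerivAt (fun s => Complex.exp (k * s)) (Complex.exp (k * s) * k) s := by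
    intro s
    simpa using ((hasDerivAt_id s).const_mul k).cexp
  refine of_hasDerivAt (by simp) h (by simp) ?_
  simpa [sq] using (h 0).mul_const k

lemma cos_mul (k : ℂ) : HasTwoJet (fun s => Complex.cos (k * s)) 1 0 (-k ^ 2) := by
  refine of_hasDerivAt (by simp) (hasDerivAt_cos_mul k) (by simp) ?_
  simpa [sq] using (hasDerivAt_sin_mul k 0).neg.mul_const k

lemma sin_mul (k : ℂ) : HasTwoJet (fun s => Complex.sin (k * s)) 0 k 0 := by
  refine of_hasDerivAt (by simp) (hasDerivAt_sin_mul k) (by simp) ?_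
  simpa using (hasDerivAt_cos_mul k 0).mul_const k

end HasTwoJet

lemma analyticAt_hurwitz (x : ℝ) : AnalyticAt ℂ (hurwitz x) 0 := by
  have h : DifferentiableOn ℂ (hurwitz x) {1}ᶜ := fun s hs =>
    (HurwitzZeta.differentiableAt_hurwitzZeta _ hs).differentiableWithinAt
  exact h.analyticAt (isOpen_compl_singleton.mem_nhds (by simp))

lemma div_mem_Ioc {q r : ℕ} (hr : r ∈ Finset.Ico 1 q) :
    0 < (r : ℝ) / q ∧ (r : ℝ) / q ≤ 1 := by
  obtain ⟨h1, h2⟩ := Finset.mem_Ico.1 hr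
  have hr0 : (0 : ℝ) < r := by exact_mod_cast h1
  have hrq : (r : ℝ) < q := by exact_mod_cast h2
  exact ⟨div_pos hr0 (hr0.trans hrq), (div_le_one (hr0.trans hrq)).2 hrq.le⟩

lemma hasTwoJet_hurwitz {x : ℝ} (hx : 0 < x) (hx1 : x ≤ 1) :
    HasTwoJet (hurwitz x) ((1 / 2 - x : ℝ) : ℂ)
      ((Real.log (Real.Gamma x) - Real.log (2 * Real.pi) / 2 : ℝ) : ℂ)
      (hurwitzDeriv 2 0 x) where
  analyticAt := analyticAt_hurwitz x
  value := by rw [hurwitz_zero hx hx1]; push_cast; rfl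
  deriv_one := deriv_hurwitz_zero hx hx1
  deriv_two := rfl

/-- The two-jet at `0` of a linear combination of the functions `ζ(s, r / q)`, for real weights. -/
lemma hasTwoJet_sum_hurwitz (q : ℕ) (w : ℕ → ℝ) :
    HasTwoJet (fun s => ∑ r ∈ Finset.Ico 1 q, hurwitz ((r : ℝ) / q) s * (w r : ℂ))
      ((∑ r ∈ Finset.Ico 1 q, (1 / 2 - (r : ℝ) / q) * w r : ℝ) : ℂ)
      ((∑ r ∈ Finset.Ico 1 q, Real.log (Real.Gamma ((r : ℝ) / q)) * w r
        - Real.log (2 * Real.pi) / 2 * ∑ r ∈ Finset.Ico 1 q, w r : ℝ) : ℂ)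
      (∑ r ∈ Finset.Ico 1 q, hurwitzDeriv 2 0 ((r : ℝ) / q) * (w r : ℂ)) := by
  have h := HasTwoJet.sum (Finset.Ico 1 q) fun r hr =>
    (hasTwoJet_hurwitz (div_mem_Ioc hr).1 (div_mem_Ioc hr).2).mul (HasTwoJet.const (w r : ℂ))
  convert h using 1
  · push_cast; rfl
  · push_cast
    rw [Finset.mul_sum, ← Finset.sum_sub_distrib]
    refine Finset.sum_congr rfl fun r _ => ?_
    ring
  · refine Finset.sum_congr rfl fun r _ => ?_
    ring

/-! ### Trigonometric sums -/

section trigonometric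

variable {p q : ℕ}

/-- The `q`-th root of unity `exp (2πi p / q)`. -/
noncomputable def unityRoot (p q : ℕ) : ℂ := Complex.exp ((angle p q 1 : ℝ) * Complex.I)

lemma unityRoot_pow (r : ℕ) :
    unityRoot p q ^ r = Complex.exp ((angle p q r : ℝ) * Complex.I) := by
  rw [unityRoot, ← Complex.exp_nat_mul]
  congr 1
  simp only [angle]
  push_cast
  ring

lemma unityRoot_pow_self (hq : 0 < q) : unityRoot p q ^ q = 1 := by
  have hq' : (q : ℝ) ≠ 0 := by positivity
  rw [unityRoot_pow, Complex.exp_eq_one_iff]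
  refine ⟨p, ?_⟩
  rw [angle, show 2 * Real.pi * q * p / q = 2 * Real.pi * p by field_simp]
  push_cast
  ring

lemma sin_pi_mul_div_pos (hp : 1 ≤ p) (hpq : p < q) : 0 < Real.sin (Real.pi * p / q) := by
  have hp0 : (0 : ℝ) < p := by exact_mod_cast hp
  have hpq' : (p : ℝ) < q := by exact_mod_cast hpq
  have hq0 := hp0.trans hpq'
  refine Real.sin_pos_of_pos_of_lt_pi (by positivity) ?_
  rw [div_lt_iff₀ hq0]
  exact mul_lt_mul_of_pos_left hpq' Real.pi_pos

lemma angle_one (p q : ℕ) : angle p q 1 = 2 * (Real.pi * p / q) := by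
  simp only [angle, Nat.cast_one]
  ring

lemma unityRoot_re (p q : ℕ) :
    (unityRoot p q).re = 1 - 2 * Real.sin (Real.pi * p / q) ^ 2 := by
  rw [unityRoot, Complex.exp_ofReal_mul_I_re, angle_one, Real.cos_two_mul, Real.cos_sq']
  ring

lemma unityRoot_im (p q : ℕ) :
    (unityRoot p q).im = 2 * Real.sin (Real.pi * p / q) * Real.cos (Real.pi * p / q) := by
  rw [unityRoot, Complex.exp_ofReal_mul_I_im, angle_one, Real.sin_two_mul]

lemma unityRoot_ne_one (hp : 1 ≤ p) (hpq : p < q) : unityRoot p q ≠ 1 := by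
  intro h
  have h1 := unityRoot_re p q
  have h2 := sin_pi_mul_div_pos hp hpq
  rw [h, Complex.one_re] at h1
  nlinarith [pow_pos h2 2]

lemma sum_unityRoot_pow (hp : 1 ≤ p) (hpq : p < q) :
    ∑ r ∈ Finset.range q, unityRoot p q ^ r = 0 := by
  rw [geom_sum_eq (unityRoot_ne_one hp hpq), unityRoot_pow_self (by omega), sub_self, zero_div]

lemma sum_natCast_mul_pow_mul_sub_one (z : ℂ) (n : ℕ) :
    (∑ r ∈ Finset.range n, (r : ℂ) * z ^ r) * (z - 1)
      = n * z ^ n - z * ∑ r ∈ Finset.range n, z ^ r := by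
  induction n with
  | zero => simp
  | succ n ih =>
    rw [Finset.sum_range_succ, Finset.sum_range_succ, add_mul, ih]
    push_cast
    ring

lemma one_add_sum_cos_add_sum_sin (hp : 1 ≤ p) (hpq : p < q) :
    (1 + ∑ r ∈ Finset.Ico 1 q, Real.cos (angle p q r) = 0) ∧
      ∑ r ∈ Finset.Ico 1 q, Real.sin (angle p q r) = 0 := by
  have h := sum_unityRoot_pow hp hpq
  rw [sum_range_eq_add_sum_Ico_one (by omega), pow_zero] at h
  simp only [unityRoot_pow] at h
  have h1 := congrArg Complex.re h
  have h2 := congrArg Complex.im h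
  simp only [Complex.add_re, Complex.add_im, Complex.re_sum, Complex.im_sum,
    Complex.exp_ofReal_mul_I_re, Complex.exp_ofReal_mul_I_im, Complex.one_re, Complex.one_im,
    Complex.zero_re, Complex.zero_im, zero_add] at h1 h2
  exact ⟨h1, h2⟩

lemma sum_half_sub_mul_sin (hp : 1 ≤ p) (hpq : p < q) :
    ∑ r ∈ Finset.Ico 1 q, (1 / 2 - (r : ℝ) / q) * Real.sin (angle p q r)
      = Real.cot (Real.pi * p / q) / 2 := by
  have hq : 0 < q := by omega
  have hz := sub_ne_zero.2 (unityRoot_ne_one hp hpq)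
  have h := sum_natCast_mul_pow_mul_sub_one (unityRoot p q) q
  rw [sum_unityRoot_pow hp hpq, unityRoot_pow_self hq, mul_zero, sub_zero, mul_one,
    ← eq_div_iff hz, sum_range_eq_add_sum_Ico_one hq] at h
  have hre := unityRoot_re p q
  have him := unityRoot_im p q
  have hs := sin_pi_mul_div_pos hp hpq
  have hcs := Real.sin_sq_add_cos_sq (Real.pi * p / q)
  have h2 := congrArg Complex.im h
  simp only [unityRoot_pow, Nat.cast_zero, zero_mul, zero_add, Complex.im_sum,
    ← Complex.ofReal_natCast, Complex.im_ofReal_mul, Complex.exp_ofReal_mul_I_im] at h2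
  have hq' : (q : ℝ) ≠ 0 := by positivity
  have hsum : ∑ r ∈ Finset.Ico 1 q, (1 / 2 - (r : ℝ) / q) * Real.sin (angle p q r)
      = -(∑ r ∈ Finset.Ico 1 q, (r : ℝ) * Real.sin (angle p q r)) / q := by
    have h0 := (one_add_sum_cos_add_sum_sin hp hpq).2
    simp only [sub_mul, Finset.sum_sub_distrib, ← Finset.mul_sum, h0, neg_div, Finset.sum_div]
    simp [div_mul_eq_mul_div]
  rw [hsum, h2, div_eq_mul_inv (Complex.ofReal _), Complex.im_ofReal_mul, Complex.inv_im,
    Complex.normSq_apply, Complex.sub_re, Complex.sub_im, hre, him, Real.cot_eq_cos_div_sin]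
  simp only [Complex.one_re, Complex.one_im]
  set S := Real.sin (Real.pi * p / q)
  set C := Real.cos (Real.pi * p / q)
  have hden : (1 - 2 * S ^ 2 - 1) * (1 - 2 * S ^ 2 - 1) + (2 * S * C - 0) * (2 * S * C - 0)
      = 4 * S ^ 2 := by
    linear_combination (4 * S ^ 2) * hcs
  rw [hden]
  field_simp
  ring

end trigonometric

/-- The regular parts at the pole differ by the entire function `ζ(s, x) - ζ(s, 1)`, the polar
terms cancelling. -/
lemma stieltjes_one_sub_stieltjes_one (x : ℝ) :
    stieltjes 1 x - stieltjes 1 1 = -deriv (fun s => hurwitz x s - hurwitz 1 s) 1 := by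
  have h : (fun s => hurwitz x s - hurwitz 1 s) = fun s => regularPart x s - regularPart 1 s := by
    have hc : Continuous fun s => hurwitz x s - hurwitz 1 s :=
      (HurwitzZeta.differentiable_hurwitzZeta_sub_hurwitzZeta _ _).continuous
    have hc' : Continuous fun s => regularPart x s - regularPart 1 s :=
      ((differentiable_regularPart x).sub (differentiable_regularPart 1)).continuous
    refine hc.ext_on (dense_compl_singleton (1 : ℂ)) hc' fun s hs => ?_
    have hs' : s ≠ 1 := hs
    simp [regularPart, Function.update_of_ne hs']
  rw [h, deriv_fun_sub (differentiable_regularPart x 1) (differentiable_regularPart 1 1)]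
  simp only [stieltjes, iteratedDeriv_one]
  ring

/-! ### Comparison of coefficients in the functional equation -/

/-- The factor `2 Γ(s + 1) (2πq)⁻ˢ` of the functional equation. -/
noncomputable def gammaFactor (q : ℕ) (s : ℂ) : ℂ :=
  2 * (Complex.exp (-(Real.log (2 * Real.pi * q) : ℂ) * s) * Complex.Gamma (s + 1))

/-- The combination of Hurwitz zeta functions in the functional equation for
`ζ(s, p / q) - ζ(s, 1)`, with `cos (πs / 2 - 2π r p / q)` expanded by the addition theorem. The
summand `r = q` and the term from `ζ(1 - s, 1)` together make up the part with `1 - q ^ s`. -/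
noncomputable def dualSum (p q : ℕ) (s : ℂ) : ℂ :=
  Complex.cos ((Real.pi / 2 : ℂ) * s) *
      (cosTransform p q s + riemannZeta s * (1 + -1 * Complex.exp ((Real.log q : ℂ) * s)))
    + Complex.sin ((Real.pi / 2 : ℂ) * s) * sinTransform p q s

/-- The functional equation, multiplied by `s` to remove the pole of `Γ(s)` at `0`. -/
lemma mul_sub_eq_gammaFactor_mul_dualSum {p q : ℕ} (hp : 1 ≤ p) (hpq : p < q) {s : ℂ}
    (hs0 : s ≠ 0) (hs : s ∈ Metric.ball (0 : ℂ) 1) :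
    s * (hurwitz ((p : ℝ) / q) (1 - s) - hurwitz 1 (1 - s))
      = gammaFactor q s * dualSum p q s := by
  rw [mem_ball_zero_iff] at hs
  have hsn : ∀ n : ℕ, s ≠ -n := by
    rintro n rfl
    rw [norm_neg, Complex.norm_natCast] at hs
    have : n = 0 := by
      have : n < 1 := by exact_mod_cast hs
      omega
    simp [this] at hs0
  have hs1 : s ≠ 1 := by rintro rfl; simp at hs
  have hq : (0 : ℝ) < q := by exact_mod_cast (by omega : 0 < q)
  have hqC : (q : ℂ) ≠ 0 := by exact_mod_cast hq.ne'
  have hpiC : (2 * Real.pi : ℂ) ≠ 0 := by exact_mod_cast (by positivity : (2 * Real.pi) ≠ 0)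
  have e1 : (q : ℂ) ^ (-s) = Complex.exp (-(Real.log q : ℂ) * s) := by
    rw [Complex.cpow_def_of_ne_zero hqC, ← Complex.ofReal_natCast, ← Complex.ofReal_log hq.le]
    congr 1; ring
  have e2 : (2 * Real.pi : ℂ) ^ (-s) = Complex.exp (-(Real.log (2 * Real.pi) : ℂ) * s) := by
    rw [Complex.cpow_def_of_ne_zero hpiC, show (2 * Real.pi : ℂ) = ((2 * Real.pi : ℝ) : ℂ) by
      push_cast; rfl, ← Complex.ofReal_log (by positivity)]
    congr 1; ring
  have e3 : Complex.exp (-(Real.log (2 * Real.pi * q) : ℂ) * s)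
      = Complex.exp (-(Real.log (2 * Real.pi) : ℂ) * s)
        * Complex.exp (-(Real.log q : ℂ) * s) := by
    rw [← Complex.exp_add, Real.log_mul (by positivity) hq.ne']
    congr 1; push_cast; ring
  have e4 : Complex.exp (-(Real.log q : ℂ) * s) * Complex.exp ((Real.log q : ℂ) * s) = 1 := by
    rw [← Complex.exp_add]; simp
  rw [hurwitz_one_sub_rational hp hpq hsn hs1, hurwitz_one, riemannZeta_one_sub hsn hs1,
    gammaFactor, dualSum, Complex.Gamma_add_one s hs0, e1, e2, e3,
    show (Real.pi : ℂ) * s / 2 = Real.pi / 2 * s by ring]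
  linear_combination (-2 * s * Complex.exp (-(Real.log (2 * Real.pi) : ℂ) * s) * Complex.Gamma s *
    Complex.cos (Real.pi / 2 * s) * riemannZeta s) * (- e4)

/-- Only the value and first derivative are needed explicitly: in the functional equation the
second derivative is multiplied by the vanishing constant term of the dual sum. -/
lemma hasTwoJet_Gamma_add_one : HasTwoJet (fun s => Complex.Gamma (s + 1)) 1
    (-(Real.eulerMascheroniConstant : ℂ)) (iteratedDeriv 2 (fun s => Complex.Gamma (s + 1)) 0) where
  analyticAt := by
    have h : AnalyticAt ℂ Complex.Gamma (0 + 1) := by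
      have hd : DifferentiableOn ℂ Complex.Gamma {s | 0 < s.re} := fun s hs =>
        (Complex.differentiableAt_Gamma s fun m h => by
          have hs' : 0 < s.re := hs
          rw [h] at hs'
          simp at hs'
          linarith [m.cast_nonneg (α := ℝ)]).differentiableWithinAt
      exact hd.analyticAt ((isOpen_lt continuous_const Complex.continuous_re).mem_nhds (by simp))
    exact h.comp_of_eq (f := fun s : ℂ => s + 1) (by fun_prop) rfl
  value := by simp
  deriv_one := by
    rw [deriv_comp_add_const, zero_add, Complex.hasDerivAt_Gamma_one.deriv]
  deriv_two := rfl

/-- The two-jet at `0` of `s ↦ ζ(1 - s, x) - ζ(1 - s, 1)`: its derivative is `γ₁(x) - γ₁(1)`. -/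
lemma hasTwoJet_reflected_difference (x : ℝ) :
    HasTwoJet (fun s => hurwitz x (1 - s) - hurwitz 1 (1 - s))
      (hurwitz x 1 - hurwitz 1 1) (stieltjes 1 x - stieltjes 1 1)
      (iteratedDeriv 2 (fun s => hurwitz x (1 - s) - hurwitz 1 (1 - s)) 0) where
  analyticAt := Differentiable.analyticAt
    ((HurwitzZeta.differentiable_hurwitzZeta_sub_hurwitzZeta _ _).comp
      (by fun_prop : Differentiable ℂ fun s : ℂ => 1 - s)) 0
  value := by simp
  deriv_one := by
    rw [stieltjes_one_sub_stieltjes_one, deriv_comp_const_sub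
      (f := fun s => hurwitz x s - hurwitz 1 s), sub_zero]
  deriv_two := rfl

/-- Comparison of two-jets at `0` in the functional equation. The constant term of the dual sum
vanishes, and its first and second derivatives give the value and derivative at `s = 1` of
`ζ(s, p / q) - ζ(s, 1)`. -/
lemma coefficients_of_functional_equation {p q : ℕ} (hp : 1 ≤ p) (hpq : p < q) {a b c : ℂ}
    (hG : HasTwoJet (dualSum p q) a b c) :
    a = 0 ∧ hurwitz ((p : ℝ) / q) 1 - hurwitz 1 1 = 2 * b ∧
      stieltjes 1 ((p : ℝ) / q) - stieltjes 1 1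
        = c - 2 * (Real.eulerMascheroniConstant + Real.log (2 * Real.pi * q)) * b := by
  have hD := hasTwoJet_reflected_difference ((p : ℝ) / q)
  have hE := (HasTwoJet.const 2).mul
    ((HasTwoJet.exp_mul (-(Real.log (2 * Real.pi * q) : ℂ))).mul hasTwoJet_Gamma_add_one)
  have hl := HasTwoJet.id.mul hD
  have hr := hE.mul hG
  -- the equation extends to `s = 0` because both sides are continuous there
  have heq : (fun s => s * (hurwitz ((p : ℝ) / q) (1 - s) - hurwitz 1 (1 - s)))
      =ᶠ[𝓝 0] fun s => gammaFactor q s * dualSum p q s := by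
    refine (ContinuousAt.eventuallyEq_nhds_iff_eventuallyEq_nhdsNE
      hl.analyticAt.continuousAt hr.analyticAt.continuousAt).1 ?_
    filter_upwards [self_mem_nhdsWithin,
      mem_nhdsWithin_of_mem_nhds (Metric.ball_mem_nhds (0 : ℂ) one_pos)] with s h0 h1
    exact mul_sub_eq_gammaFactor_mul_dualSum hp hpq h0 h1
  have h0 := hl.value.symm.trans (heq.eq_of_nhds.trans hr.value)
  have h1 := hl.deriv_one.symm.trans (heq.deriv_eq.trans hr.deriv_one)
  have h2 := hl.deriv_two.symm.trans ((heq.iteratedDeriv_eq 2).trans hr.deriv_two)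
  have ha : a = 0 := by linear_combination -h0 / 2
  subst ha
  refine ⟨rfl, by linear_combination h1, by linear_combination h2 / 2⟩

lemma hasTwoJet_dualSum {p q : ℕ} (hp : 1 ≤ p) (hpq : p < q) :
    HasTwoJet (dualSum p q)
      ((∑ r ∈ Finset.Ico 1 q, (1 / 2 - (r : ℝ) / q) * Real.cos (angle p q r) : ℝ) : ℂ)
      ((∑ r ∈ Finset.Ico 1 q, Real.log (Real.Gamma ((r : ℝ) / q)) * Real.cos (angle p q r)
        + Real.log (2 * Real.pi) / 2 + Real.log q / 2
        + Real.pi / 4 * Real.cot (Real.pi * p / q) : ℝ) : ℂ)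
      (∑ r ∈ Finset.Ico 1 q, hurwitzDeriv 2 0 ((r : ℝ) / q) * (Real.cos (angle p q r) : ℂ)
        - (Real.pi ^ 2 / 4) * ((∑ r ∈ Finset.Ico 1 q,
          (1 / 2 - (r : ℝ) / q) * Real.cos (angle p q r) : ℝ) : ℂ)
        + ((Real.pi * ∑ r ∈ Finset.Ico 1 q,
            Real.log (Real.Gamma ((r : ℝ) / q)) * Real.sin (angle p q r) : ℝ) : ℂ)
        + ((Real.log q ^ 2 / 2 + Real.log q * Real.log (2 * Real.pi) : ℝ) : ℂ)) := by
  have hA := hasTwoJet_sum_hurwitz q fun r => Real.cos (angle p q r)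
  have hB := hasTwoJet_sum_hurwitz q fun r => Real.sin (angle p q r)
  have hz := hasTwoJet_hurwitz one_pos le_rfl
  rw [show hurwitz 1 = riemannZeta from funext hurwitz_one] at hz
  have h := ((HasTwoJet.cos_mul (Real.pi / 2 : ℂ)).mul (hA.add (hz.mul
    ((HasTwoJet.const 1).add ((HasTwoJet.const (-1)).mul
      (HasTwoJet.exp_mul (Real.log q : ℂ))))))).add
    ((HasTwoJet.sin_mul (Real.pi / 2 : ℂ)).mul hB)
  obtain ⟨hcos, hsin⟩ := one_add_sum_cos_add_sum_sin hp hpq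
  have hcos' : ∑ r ∈ Finset.Ico 1 q, Real.cos (angle p q r) = -1 := by linarith
  rw [hcos', hsin, sum_half_sub_mul_sin hp hpq, Real.Gamma_one, Real.log_one] at h
  convert! h using 1
  · push_cast; ring
  · push_cast; ring
  · push_cast; ring

end StieltjesRational

theorem mainTheorem4 (p q : ℕ) (hp : 1 ≤ p) (hpq : p < q) :
    (StieltjesRational.stieltjes 1 ((p : ℝ) / (q : ℝ))
      = StieltjesRational.stieltjes 1 1
        + ((Real.eulerMascheroniConstant + Real.log (2 * Real.pi * (q : ℝ)) : ℝ) : ℂ)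
            * ((Real.eulerMascheroniConstant : ℂ) + Complex.digamma ((p : ℂ) / (q : ℂ)))
        + ∑ r ∈ Finset.Ico 1 q,
            StieltjesRational.hurwitzDeriv 2 0 ((r : ℝ) / (q : ℝ))
              * ((Real.cos (2 * Real.pi * (r : ℝ) * (p : ℝ) / (q : ℝ)) : ℝ) : ℂ)
        + ((Real.pi * ∑ r ∈ Finset.Ico 1 q,
            Real.log (Real.Gamma ((r : ℝ) / (q : ℝ)))
              * Real.sin (2 * Real.pi * (r : ℝ) * (p : ℝ) / (q : ℝ)) : ℝ) : ℂ)
        + ((Real.log (q : ℝ) ^ 2 / 2 + Real.log (q : ℝ) * Real.log (2 * Real.pi) : ℝ) : ℂ))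
    ∧
    (StieltjesRational.stieltjes 1 ((p : ℝ) / (q : ℝ))
      = StieltjesRational.stieltjes 1 1
        - (((Real.eulerMascheroniConstant + Real.log (2 * Real.pi))
              * Real.log (2 * Real.pi * (q : ℝ)) : ℝ) : ℂ)
        - ((Real.log (q : ℝ) ^ 2 / 2 : ℝ) : ℂ)
        + ∑ r ∈ Finset.Ico 1 q,
            StieltjesRational.hurwitzDeriv 2 0 ((r : ℝ) / (q : ℝ))
              * ((Real.cos (2 * Real.pi * (r : ℝ) * (p : ℝ) / (q : ℝ)) : ℝ) : ℂ)
        - ((2 * (Real.eulerMascheroniConstant + Real.log (2 * Real.pi * (q : ℝ)))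
            * ∑ r ∈ Finset.Ico 1 q,
                Real.log (Real.Gamma ((r : ℝ) / (q : ℝ)))
                  * Real.cos (2 * Real.pi * (r : ℝ) * (p : ℝ) / (q : ℝ)) : ℝ) : ℂ)
        + ((Real.pi * ∑ r ∈ Finset.Ico 1 q,
            Real.log (Real.Gamma ((r : ℝ) / (q : ℝ)))
              * Real.sin (2 * Real.pi * (r : ℝ) * (p : ℝ) / (q : ℝ)) : ℝ) : ℂ)
        - ((Real.pi / 2
            * (Real.eulerMascheroniConstant + Real.log (2 * Real.pi * (q : ℝ)))
            * Real.cot (Real.pi * (p : ℝ) / (q : ℝ)) : ℝ) : ℂ)) := by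
  have hG := StieltjesRational.hasTwoJet_dualSum hp hpq
  obtain ⟨h0, h1, h2⟩ := StieltjesRational.coefficients_of_functional_equation hp hpq hG
  have hmem := StieltjesRational.div_mem_Ioc (Finset.mem_Ico.2 ⟨hp, hpq⟩)
  have hpsi := StieltjesRational.hurwitz_sub_hurwitz_one_at_one hmem.1 hmem.2
  rw [h0] at h2
  rw [h1] at hpsi
  simp only [Complex.ofReal_div, Complex.ofReal_natCast] at hpsi
  have hq : (0 : ℝ) < q := by exact_mod_cast (by omega : 0 < q)
  have hlog : Real.log (2 * Real.pi * q) = Real.log (2 * Real.pi) + Real.log q :=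
    Real.log_mul (by positivity) hq.ne'
  simp only [StieltjesRational.angle] at h2 hpsi
  -- the first derivative of the dual sum at `0` is eliminated through the digamma function in the
  -- first formula, and left as an explicit sum in the second
  constructor
  · push_cast at h2 hpsi ⊢
    linear_combination h2 - (Real.eulerMascheroniConstant + Real.log (2 * Real.pi * q) : ℂ) * hpsi
  · rw [hlog] at h2 ⊢
    push_cast at h2 ⊢
    linear_combination h2
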